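/- For real numbers $x\ge 0$ and $y>0$ let $$g(x,y)=2\pi y\cdot \exp\Bigl(\frac{1}{3y}\Bigr)\cdot\Bigl(\frac{y}{e}\Bigr)^{y}\cdot\Bigl(1-\frac{x}{y^{2}}\Bigr)^{y},$$ and for positive integers $a$ define $f(a)$ recursively by $$f(1)=e,\qquad f(a+1)=f(a)+1+\frac{1}{2f(a)}+\frac{0.6}{2f(a)^{2}}\quad(a\ge 1).$$ Let $n\ge 2$ be an integer and write $[n]=\{1,\dots,n\}$. (1) Let $A$ be an $n\times n$ matrix with entries in $\{0,1\}$, and let $\rho$ be the number of zero entries of $A$. If every row sum and every column sum of $A$ is larger than $n-\sqrt{(n-2)/20}$, then the permanent of $A$ satisfies $$\frac{g(\rho,n)}{\sqrt{2\pi n}\;e^{2}}\;\le\;\mathrm{per}(A)\;\le\;19\cdot\frac{g(\rho,n)}{\sqrt{2\pi n}\;e^{2}}.$$ (2) Let $R_1,\dots,R_n\subseteq[n]$ satisfy $|R_i|\ge n-\sqrt{(n-2)/20}$ for every $i\in[n]$ and $|\{k\in[n]: j\in R_k\}|\ge n-\sqrt{(n-2)/20}$ for every $j\in[n]$. Let $\rho=n^2-\sum_{i\in[n]}|R_i|$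 and let $\Omega$ be the set of permutations $\sigma$ of $[n]$ with $\sigma(i)\in R_i$ for every $i\in[n]$. Then $$\frac{g(\rho,n)}{\sqrt{2\pi n}\;e^{2}}\;\le\;|\Omega|\;\le\;\prod_{i\in[n]}\frac{f(|R_i|)}{e}\;\le\;19\cdot\frac{g(\rho,n)}{\sqrt{2\pi n}\;e^{2}}.$$ -/

import Mathlib

noncomputable section

/-- `g(x, y) = 2πy · exp(1/(3y)) · (y/e)^y · (1 - x/y²)^y`, meant for `x ≥ 0` and `y > 0`. -/
def gEst (x y : ℝ) : ℝ :=
  2 * Real.pi * y * Real.exp (1 / (3 * y)) * (y / Real.exp 1) ^ y * (1 - x / y ^ 2) ^ y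

/-- The recursively defined sequence `f(1) = e`,
`f(a+1) = f(a) + 1 + 1/(2 f(a)) + 0.6/(2 f(a)²)` for `a ≥ 1`.
The value at `0` is a placeholder outside the domain. -/
def huberF : ℕ → ℝ
  | 0 => 0
  | 1 => Real.exp 1
  | a + 2 =>
    huberF (a + 1) + 1 + 1 / (2 * huberF (a + 1)) + 0.6 / (2 * huberF (a + 1) ^ 2)

/-- The number of zero entries of a matrix. -/
def zeroCount {n : ℕ} (A : Matrix (Fin n) (Fin n) ℝ) : ℕ :=
  Finset.card {p : Fin n × Fin n | A p.1 p.2 = 0}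

/-- The permutations `σ` of `[n]` lying in `R₁ × ⋯ × Rₙ`, that is, with `σ(i) ∈ Rᵢ` for all `i`. -/
def prpSolutions {n : ℕ} (R : Fin n → Finset (Fin n)) : Finset (Equiv.Perm (Fin n)) :=
  {σ | ∀ i, σ i ∈ R i}

end

/-! Part (1) is part (2) for the sets of positions of ones in the rows, so everything reduces to
counting permutations with `σ i ∈ R i`.

The upper bound is a Bregman-type inequality, proved by induction on the size by expanding along one
column. Writing f for `huberF`, the recursion is tuned so that f(a)·exp(1/f(a)) ≤ f(a+1)
(`huberF_mul_exp_le`). Combined with e·y ≤ exp y for y = ∑ 1/f, this makes the expansion close up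
(`sum_prod_erase_huberF_le`).

The lower bound is a lopsided local lemma. If each row and column has at most D forbidden cells, a
uniform permutation avoids k of them with probability at least (1-x)^k, for x slightly above 1/n
(`pow_mul_avoidCount_le`). A switching argument supplies the negative correlation it needs.

To compare both bounds with g, let d be the mean number of missing elements per row. Below,
Stirling's bound gives n!, and the loss in the exponent fits into the factor e^(-2). Above, f(a) ≤ a
+ (log a)/2 + 1.62 and convexity of exp replace every row size by the mean n - d; what remains is at
most 19·√(2πn)/e². -/

/-! ### The sequence `huberF` -/

theorem huberF_succ_of_pos {a : ℕ} (ha : 1 ≤ a) :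
    huberF (a + 1) = huberF a + 1 + 1 / (2 * huberF a) + 0.6 / (2 * huberF a ^ 2) := by
  obtain ⟨b, rfl⟩ := Nat.exists_eq_add_of_le' ha
  rfl

theorem add_le_huberF {a : ℕ} (ha : 1 ≤ a) : (a : ℝ) + 1.7 ≤ huberF a := by
  induction a, ha using Nat.le_induction with
  | base =>
    have := Real.exp_one_gt_d9
    simp only [huberF, Nat.cast_one]
    linarith
  | succ a ha ih =>
    have hpos : 0 < huberF a := by
      have : (0 : ℝ) ≤ a := Nat.cast_nonneg a
      linarith
    rw [huberF_succ_of_pos ha]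
    have h1 : 0 < 1 / (2 * huberF a) := by positivity
    have h2 : 0 < 0.6 / (2 * huberF a ^ 2) := by positivity
    push_cast
    linarith

theorem huberF_pos {a : ℕ} (ha : 1 ≤ a) : 0 < huberF a := by
  have := add_le_huberF ha
  have : (0 : ℝ) ≤ a := Nat.cast_nonneg a
  linarith

theorem huberF_nonneg (a : ℕ) : 0 ≤ huberF a := by
  rcases Nat.eq_zero_or_pos a with rfl | ha
  · exact le_rfl
  · exact (huberF_pos ha).le

theorem huberF_le_succ (a : ℕ) : huberF a ≤ huberF (a + 1) := by
  rcases Nat.eq_zero_or_pos a with rfl | ha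
  · exact huberF_nonneg _
  · rw [huberF_succ_of_pos ha]
    have hpos := huberF_pos ha
    have h1 : 0 < 1 / (2 * huberF a) := by positivity
    have h2 : 0 < 0.6 / (2 * huberF a ^ 2) := by positivity
    linarith

theorem exp_le_cubic {x : ℝ} (h0 : 0 ≤ x) (h1 : x ≤ 1) :
    Real.exp x ≤ 1 + x + x ^ 2 / 2 + 0.3 * x ^ 3 := by
  have h := Real.exp_bound' h0 h1 (n := 3) (by norm_num)
  norm_num [Finset.sum_range_succ, Nat.factorial] at h
  have : 0 ≤ x ^ 3 := by positivity
  linarith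

/-- With x = 1/f(a), the recursion reads f(a+1) = f(a)(1 + x + x²/2 + 0.3x³), and this cubic
dominates exp x on [0, 1]. -/
theorem huberF_mul_exp_le {a : ℕ} (ha : 1 ≤ a) :
    huberF a * Real.exp (1 / huberF a) ≤ huberF (a + 1) := by
  have hpos := huberF_pos ha
  have hge : 1 ≤ huberF a := by
    have := add_le_huberF ha
    have : (0 : ℝ) ≤ a := Nat.cast_nonneg a
    linarith
  have h := exp_le_cubic (x := 1 / huberF a) (by positivity) ((div_le_one hpos).2 hge)
  calc _ ≤ huberF a * _ := mul_le_mul_of_nonneg_left h hpos.le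
    _ = huberF (a + 1) := by
      rw [huberF_succ_of_pos ha]
      field_simp
      ring

/-! ### Upper bound by column expansion -/

/-- The bound `∏ huberF (r i) / e` is supermultiplicative along the expansion in one column. -/
theorem sum_prod_erase_huberF_le {α : Type*} [DecidableEq α] (S : Finset α) (r : α → ℕ) :
    ∑ a ∈ S, ∏ x ∈ S.erase a, huberF (r x) / Real.exp 1
      ≤ ∏ x ∈ S, huberF (r x + 1) / Real.exp 1 := by
  have he := Real.exp_pos 1
  have hnn : ∀ k, 0 ≤ huberF k / Real.exp 1 := fun k => div_nonneg (huberF_nonneg k) he.le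
  by_cases h : ∃ a ∈ S, r a = 0
  · obtain ⟨a, haS, ha⟩ := h
    rw [Finset.sum_eq_single_of_mem a haS, ← Finset.mul_prod_erase S _ haS, ha]
    · have h1 : huberF (0 + 1) / Real.exp 1 = 1 := div_self he.ne'
      rw [h1, one_mul]
      refine Finset.prod_le_prod (fun x _ => hnn _) fun x _ => ?_
      exact div_le_div_of_nonneg_right (huberF_le_succ _) he.le
    · intro b _ hb
      refine Finset.prod_eq_zero (Finset.mem_erase.2 ⟨hb.symm, haS⟩) ?_
      simp [ha, huberF]
  · push Not at h
    have hr : ∀ a ∈ S, 1 ≤ r a := fun a ha => Nat.one_le_iff_ne_zero.2 (h a ha)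
    have hG : ∀ a ∈ S, 0 < huberF (r a) / Real.exp 1 := fun a ha =>
      div_pos (huberF_pos (hr a ha)) he
    have hP : 0 ≤ ∏ x ∈ S, huberF (r x) / Real.exp 1 := Finset.prod_nonneg fun x _ => hnn _
    -- Dividing by the full product P leaves e·y with y = ∑ 1/f(r a); then e·y ≤ exp y, and exp y
    -- splits into one factor per row.
    calc ∑ a ∈ S, ∏ x ∈ S.erase a, huberF (r x) / Real.exp 1
        = ∑ a ∈ S, (∏ x ∈ S, huberF (r x) / Real.exp 1) *
            (Real.exp 1 * (1 / huberF (r a))) := by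
          refine Finset.sum_congr rfl fun a ha => ?_
          rw [← Finset.mul_prod_erase S _ ha]
          have := (huberF_pos (hr a ha)).ne'
          field_simp
      _ = (∏ x ∈ S, huberF (r x) / Real.exp 1) *
            (Real.exp 1 * ∑ a ∈ S, 1 / huberF (r a)) := by
          rw [Finset.mul_sum, Finset.mul_sum]
      _ ≤ (∏ x ∈ S, huberF (r x) / Real.exp 1) * Real.exp (∑ a ∈ S, 1 / huberF (r a)) := by
          refine mul_le_mul_of_nonneg_left ?_ hP
          have h1 := Real.add_one_le_exp (∑ a ∈ S, 1 / huberF (r a) - 1)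
          rw [Real.exp_sub, le_div_iff₀ he] at h1
          linarith
      _ = ∏ x ∈ S, huberF (r x) * Real.exp (1 / huberF (r x)) / Real.exp 1 := by
          rw [Real.exp_sum, ← Finset.prod_mul_distrib]
          exact Finset.prod_congr rfl fun x _ => by ring
      _ ≤ _ := by
          refine Finset.prod_le_prod (fun x _ => ?_) fun x hx => ?_
          · exact div_nonneg (mul_nonneg (huberF_nonneg _) (Real.exp_pos _).le) he.le
          · exact div_le_div_of_nonneg_right (huberF_mul_exp_le (hr x hx)) he.le

/-- Permutations are sorted by the row a that takes a fixed column b; deleting a and b leaves a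
smaller instance. Arbitrary index types let the induction pass to the subtypes. -/
theorem card_equiv_filter_le_prod_huberF (m : ℕ) :
    ∀ (α β : Type) [Fintype α] [DecidableEq α] [Fintype β] [DecidableEq β],
      Fintype.card α = m → ∀ R : α → Finset β,
      ((Finset.univ.filter fun σ : α ≃ β => ∀ i, σ i ∈ R i).card : ℝ)
        ≤ ∏ i, huberF (R i).card / Real.exp 1 := by
  have he := Real.exp_pos 1
  have hnn : ∀ k, 0 ≤ huberF k / Real.exp 1 := fun k => div_nonneg (huberF_nonneg k) he.le
  induction m with
  | zero =>
    intro α β _ _ _ _ hα R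
    have : IsEmpty α := Fintype.card_eq_zero_iff.1 hα
    rw [Fintype.prod_empty]
    have : (Finset.univ.filter fun σ : α ≃ β => ∀ i, σ i ∈ R i).card ≤ 1 :=
      Finset.card_le_one.2 fun σ _ τ _ => Equiv.ext fun a => isEmptyElim a
    exact_mod_cast this
  | succ m ih =>
    intro α β _ _ _ _ hα R
    set Ω := Finset.univ.filter fun σ : α ≃ β => ∀ i, σ i ∈ R i with hΩ
    rcases Ω.eq_empty_or_nonempty with h0 | ⟨σ₀, -⟩
    · rw [h0, Finset.card_empty, Nat.cast_zero]
      exact Finset.prod_nonneg fun _ _ => hnn _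
    obtain ⟨a₀⟩ : Nonempty α := Fintype.card_pos_iff.1 (by omega)
    set b := σ₀ a₀
    set S : Finset α := Finset.univ.filter fun a => b ∈ R a with hS
    have hmaps : ∀ σ ∈ Ω, σ.symm b ∈ S := by
      intro σ hσ
      have := (Finset.mem_filter.1 hσ).2 (σ.symm b)
      simpa [hS] using this
    have hfib : ∀ a, ((Ω.filter fun σ => σ.symm b = a).card : ℝ)
        ≤ ∏ x ∈ Finset.univ.erase a, huberF ((R x).erase b).card / Real.exp 1 := by
      intro a
      have hcard : Fintype.card {x // x ≠ a} = m := by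
        rw [Fintype.card_subtype_compl, Fintype.card_subtype_eq, hα]; rfl
      have h := ih {x // x ≠ a} {y // y ≠ b} hcard fun x => (R x).subtype (· ≠ b)
      have hprod : ∏ x ∈ Finset.univ.erase a, huberF ((R x).erase b).card / Real.exp 1
          = ∏ x : {x // x ≠ a}, huberF ((R x).subtype (· ≠ b)).card / Real.exp 1 := by
        rw [Finset.prod_subtype (p := (· ≠ a)) (Finset.univ.erase a) (by simp)]
        refine Finset.prod_congr rfl fun x _ => ?_
        rw [Finset.card_subtype, Finset.filter_ne']
      rw [hprod]
      refine le_trans ?_ h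
      rw [Nat.cast_le]
      have hiff : ∀ σ : α ≃ β, σ.symm b = a → ∀ x, x ≠ a ↔ σ x ≠ b := by
        rintro σ rfl x
        rw [not_iff_not, Equiv.eq_symm_apply]
      -- The `else` branch is a junk value: any equivalence sending a to b will do.
      refine Finset.card_le_card_of_injOn
        (fun σ => if hσ : σ.symm b = a then σ.subtypeEquiv (hiff σ hσ) else
          (σ₀.trans (Equiv.swap b (σ₀ a))).subtypeEquiv (hiff _ (by simp))) ?_ ?_
      · intro σ hσ
        obtain ⟨h1, h2⟩ := Finset.mem_filter.1 hσ
        have h1 := (Finset.mem_filter.1 h1).2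
        simp [h2, h1]
      · intro σ hσ τ hτ hst
        have hσ := (Finset.mem_filter.1 hσ).2
        have hτ := (Finset.mem_filter.1 hτ).2
        simp only [hσ, hτ, dif_pos] at hst
        ext x
        by_cases hx : x = a
        · rw [hx, ← (Equiv.symm_apply_eq σ).1 hσ, ← (Equiv.symm_apply_eq τ).1 hτ]
        · have := congrArg (fun e => ((e ⟨x, hx⟩ : {y // y ≠ b}) : β)) hst
          simpa using this
    have hin : ∀ x ∈ S, (R x).card = ((R x).erase b).card + 1 := fun x hx =>
      (Finset.card_erase_add_one (Finset.mem_filter.1 hx).2).symm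
    have hout : ∀ x ∈ Sᶜ, (R x).card = ((R x).erase b).card := fun x hx => by
      rw [Finset.erase_eq_of_notMem]
      simpa [hS] using hx
    have hC : 0 ≤ ∏ x ∈ Sᶜ, huberF ((R x).erase b).card / Real.exp 1 :=
      Finset.prod_nonneg fun _ _ => hnn _
    calc (Ω.card : ℝ) = ∑ a ∈ S, ((Ω.filter fun σ => σ.symm b = a).card : ℝ) := by
          exact_mod_cast Finset.card_eq_sum_card_fiberwise hmaps
      _ ≤ ∑ a ∈ S, ∏ x ∈ Finset.univ.erase a, huberF ((R x).erase b).card / Real.exp 1 :=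
          Finset.sum_le_sum fun a _ => hfib a
      _ = (∑ a ∈ S, ∏ x ∈ S.erase a, huberF ((R x).erase b).card / Real.exp 1) *
            ∏ x ∈ Sᶜ, huberF ((R x).erase b).card / Real.exp 1 := by
          rw [Finset.sum_mul]
          refine Finset.sum_congr rfl fun a ha => ?_
          rw [← Finset.prod_union]
          · refine Finset.prod_congr ?_ fun _ _ => rfl
            ext x
            by_cases hx : x ∈ S <;> simp [hx]
            rintro rfl
            exact hx ha
          · exact Finset.disjoint_of_subset_left (Finset.erase_subset _ _) disjoint_compl_right
      _ ≤ (∏ x ∈ S, huberF (((R x).erase b).card + 1) / Real.exp 1) *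
            ∏ x ∈ Sᶜ, huberF ((R x).erase b).card / Real.exp 1 :=
          mul_le_mul_of_nonneg_right (sum_prod_erase_huberF_le S _) hC
      _ = ∏ i, huberF (R i).card / Real.exp 1 := by
          rw [← Finset.prod_mul_prod_compl S fun i => huberF (R i).card / Real.exp 1]
          congr 1
          · exact Finset.prod_congr rfl fun x hx => by rw [hin x hx]
          · exact Finset.prod_congr rfl fun x hx => by rw [← hout x hx]

/-! ### Lower bound by a lopsided local lemma -/

/-- The number of permutations whose graph avoids the set `S` of cells. -/
def avoidCount {α : Type*} [Fintype α] [DecidableEq α] (S : Finset (α × α)) : ℕ :=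
  (Finset.univ.filter fun σ : Equiv.Perm α => ∀ i, (i, σ i) ∉ S).card

theorem avoidCount_empty {α : Type*} [Fintype α] [DecidableEq α] :
    avoidCount (∅ : Finset (α × α)) = (Fintype.card α).factorial := by
  simp [avoidCount, Fintype.card_perm]

/-- Switching: fixing one cell outside the rows and columns of `S` is negatively correlated with
avoiding `S`. -/
theorem card_mul_card_avoid_le {α : Type*} [Fintype α] [DecidableEq α] (S : Finset (α × α))
    (i j : α) (hS : ∀ p ∈ S, p.1 ≠ i ∧ p.2 ≠ j) :
    Fintype.card α *
      (Finset.univ.filter fun σ : Equiv.Perm α => (∀ k, (k, σ k) ∉ S) ∧ σ i = j).card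
      ≤ avoidCount S := by
  rw [← Finset.card_univ, ← Finset.card_product, avoidCount]
  -- The swap moves the value j from row i to row k. The changed cells lie in row i or column j,
  -- which `S` does not meet, and k is recovered as the row taking j.
  refine Finset.card_le_card_of_injOn (fun p => p.2 * Equiv.swap i p.1) ?_ ?_
  · rintro ⟨k, σ⟩ h
    obtain ⟨h1, rfl⟩ := (Finset.mem_filter.1 (Finset.mem_product.1 h).2).2
    refine Finset.mem_coe.2 (Finset.mem_filter.2 ⟨Finset.mem_univ _, fun l hl => ?_⟩)
    have hne := hS _ hl
    simp only [Equiv.Perm.mul_apply] at hl hne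
    have hlk : l ≠ k := by
      rintro rfl
      simp at hne
    rw [Equiv.swap_apply_of_ne_of_ne hne.1 hlk] at hl
    exact h1 l hl
  · rintro ⟨k, σ⟩ h ⟨l, τ⟩ h' heq
    have h1 := (Finset.mem_filter.1 (Finset.mem_product.1 h).2).2.2
    have h2 := (Finset.mem_filter.1 (Finset.mem_product.1 h').2).2.2
    simp only at heq h1 h2
    have hk : (σ * Equiv.swap i k) k = j := by simp [h1]
    have hl : (τ * Equiv.swap i l) l = j := by simp [h2]
    have hkl : k = l := by
      rw [heq] at hk
      exact (τ * Equiv.swap i l).injective (hk.trans hl.symm)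
    subst hkl
    rw [mul_left_inj] at heq
    rw [heq]

theorem avoidCount_erase {α : Type*} [Fintype α] [DecidableEq α] (S : Finset (α × α))
    (e : α × α) (he : e ∈ S) :
    avoidCount (S.erase e) = avoidCount S +
      (Finset.univ.filter fun σ : Equiv.Perm α =>
        (∀ k, (k, σ k) ∉ S.erase e) ∧ σ e.1 = e.2).card := by
  rw [avoidCount, avoidCount, add_comm,
    ← Finset.card_filter_add_card_filter_not (fun σ : Equiv.Perm α => σ e.1 = e.2),
    Finset.filter_filter, Finset.filter_filter]
  congr 2
  ext σ
  simp only [Finset.mem_filter, Finset.mem_univ, true_and]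
  constructor
  · rintro ⟨h1, h2⟩ k hk
    refine h1 k (Finset.mem_erase.2 ⟨?_, hk⟩)
    rintro rfl
    exact h2 rfl
  · intro h
    refine ⟨fun k hk => h k (Finset.mem_of_mem_erase hk), fun h2 => h e.1 ?_⟩
    rw [h2]
    exact he

/-- A lopsided local lemma for random permutations avoiding a sparse set of cells. -/
theorem pow_mul_avoidCount_le {α : Type*} [Fintype α] [DecidableEq α] [Nonempty α] {D : ℕ} {x : ℝ}
    (hx0 : 0 ≤ x) (hx1 : x ≤ 1)
    (hx : 1 ≤ Fintype.card α * (x * (1 - x) ^ (2 * D))) (m : ℕ) :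
    ∀ S : Finset (α × α), S.card = m → (∀ i, (S.filter fun p => p.1 = i).card ≤ D) →
      (∀ j, (S.filter fun p => p.2 = j).card ≤ D) → ∀ T ⊆ S,
      (1 - x) ^ (S \ T).card * avoidCount T ≤ (avoidCount S : ℝ) := by
  induction m with
  | zero =>
    intro S hS _ _ T hT
    rw [Finset.card_eq_zero] at hS
    subst hS
    rw [Finset.subset_empty.1 hT]
    simp
  | succ m ih =>
    intro S hS hrow hcol T hT
    by_cases hTS : S ⊆ T
    · rw [Finset.Subset.antisymm hT hTS]
      simp
    obtain ⟨e, heS, heT⟩ := Finset.not_subset.1 hTS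
    have hsub : S.erase e ⊆ S := Finset.erase_subset _ _
    have ih' := ih (S.erase e) (by rw [Finset.card_erase_of_mem heS, hS]; rfl)
      (fun i => (Finset.card_le_card (Finset.filter_subset_filter _ hsub)).trans (hrow i))
      (fun j => (Finset.card_le_card (Finset.filter_subset_filter _ hsub)).trans (hcol j))
    have hT' : T ⊆ S.erase e := fun p hp =>
      Finset.mem_erase.2 ⟨fun h => heT (h ▸ hp), hT hp⟩
    have h1 := ih' T hT'
    -- `U` keeps the cells sharing no row or column with `e`. Switching gives n·B ≤ `avoidCount U`,
    -- and restoring the at most 2D other cells costs a factor (1-x)^(2D), so the hypothesis on x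
    -- yields B ≤ x·`avoidCount (S.erase e)`.
    set U := (S.erase e).filter fun p => p.1 ≠ e.1 ∧ p.2 ≠ e.2 with hU
    have h2 := ih' U (Finset.filter_subset _ _)
    have hUc : (S.erase e \ U).card ≤ 2 * D := by
      have : S.erase e \ U ⊆ (S.filter fun p => p.1 = e.1) ∪ S.filter fun p => p.2 = e.2 := by
        intro p hp
        simp only [hU, Finset.mem_sdiff, Finset.mem_filter, Finset.mem_union] at hp ⊢
        have := hsub hp.1
        tauto
      calc _ ≤ _ := Finset.card_le_card this
        _ ≤ _ := Finset.card_union_le _ _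
        _ ≤ 2 * D := by rw [two_mul]; exact add_le_add (hrow _) (hcol _)
    have h3 : (1 - x) ^ (2 * D) * avoidCount U ≤ (avoidCount (S.erase e) : ℝ) :=
      (mul_le_mul_of_nonneg_right (pow_le_pow_of_le_one (by linarith) (by linarith) hUc)
        (Nat.cast_nonneg _)).trans h2
    set B := (Finset.univ.filter fun σ : Equiv.Perm α =>
        (∀ k, (k, σ k) ∉ S.erase e) ∧ σ e.1 = e.2).card with hB
    have h4 : Fintype.card α * B ≤ avoidCount U := by
      refine le_trans (Nat.mul_le_mul_left _ (Finset.card_le_card ?_))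
        (card_mul_card_avoid_le U e.1 e.2 fun p hp => (Finset.mem_filter.1 hp).2)
      intro σ hσ
      simp only [Finset.mem_filter, Finset.mem_univ, true_and] at hσ ⊢
      exact ⟨fun k hk => hσ.1 k (Finset.mem_filter.1 hk).1, hσ.2⟩
    have hn : (0 : ℝ) < Fintype.card α := by exact_mod_cast Fintype.card_pos
    have h4' : (Fintype.card α : ℝ) * B ≤ avoidCount U := by exact_mod_cast h4
    have h5 : (B : ℝ) ≤ x * avoidCount (S.erase e) := by
      refine le_of_mul_le_mul_left ?_ hn
      calc (Fintype.card α : ℝ) * B ≤ 1 * avoidCount U := by rw [one_mul]; exact h4'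
        _ ≤ (Fintype.card α * (x * (1 - x) ^ (2 * D))) * avoidCount U :=
          mul_le_mul_of_nonneg_right hx (Nat.cast_nonneg _)
        _ = Fintype.card α * (x * ((1 - x) ^ (2 * D) * avoidCount U)) := by ring
        _ ≤ _ := mul_le_mul_of_nonneg_left (mul_le_mul_of_nonneg_left h3 hx0) hn.le
    have h6 : (avoidCount (S.erase e) : ℝ) = avoidCount S + B := by
      exact_mod_cast avoidCount_erase S e heS
    have h7 : (S \ T).card = (S.erase e \ T).card + 1 := by
      rw [← Finset.card_erase_add_one (Finset.mem_sdiff.2 ⟨heS, heT⟩), Finset.erase_sdiff_comm]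
    rw [h7, pow_succ]
    calc (1 - x) ^ (S.erase e \ T).card * (1 - x) * avoidCount T
        = (1 - x) * ((1 - x) ^ (S.erase e \ T).card * avoidCount T) := by ring
      _ ≤ (1 - x) * avoidCount (S.erase e) := mul_le_mul_of_nonneg_left h1 (by linarith)
      _ ≤ avoidCount S := by linarith

/-- Permutations avoiding `S` when every row and column of `S` has at most `D` cells. -/
theorem pow_card_mul_factorial_le_avoidCount {n D : ℕ} {x : ℝ} (hn : 0 < n) (hx0 : 0 ≤ x)
    (hx1 : x ≤ 1) (hx : 1 ≤ n * (x * (1 - x) ^ (2 * D))) (S : Finset (Fin n × Fin n))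
    (hrow : ∀ i, (S.filter fun p => p.1 = i).card ≤ D)
    (hcol : ∀ j, (S.filter fun p => p.2 = j).card ≤ D) :
    (1 - x) ^ S.card * n.factorial ≤ (avoidCount S : ℝ) := by
  have : Nonempty (Fin n) := ⟨⟨0, hn⟩⟩
  have h := pow_mul_avoidCount_le (α := Fin n) hx0 hx1 (by simpa using hx) _ S rfl hrow hcol ∅
    (Finset.empty_subset _)
  rwa [Finset.sdiff_empty, avoidCount_empty, Fintype.card_fin] at h

/-! ### Numerical comparison with g -/

/-- Since f(a) ≥ a + 1.7, each increment of f exceeds 1 by at most 1/(2(a+1)), hence by at most half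
the increment of log. The constant 1.62 fits at a = 2 but not at a = 1. -/
theorem huberF_le_add_log {a : ℕ} (ha : 2 ≤ a) : huberF a ≤ a + Real.log a / 2 + 1.62 := by
  induction a, ha using Nat.le_induction with
  | base =>
    have h1 := Real.exp_one_gt_d9
    have h2 := Real.exp_one_lt_d9
    have h3 := Real.log_two_gt_d9
    have h4 : huberF 2 = Real.exp 1 + 1 + 1 / (2 * Real.exp 1) + 0.6 / (2 * Real.exp 1 ^ 2) := rfl
    have h5 : 1 / (2 * Real.exp 1) ≤ 1 / (2 * 2.718) := by gcongr; linarith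
    have h6 : 0.6 / (2 * Real.exp 1 ^ 2) ≤ 0.6 / (2 * 2.718 ^ 2) := by gcongr; linarith
    rw [h4, Nat.cast_ofNat]
    norm_num at h5 h6 ⊢
    linarith
  | succ a ha ih =>
    have ha1 : 1 ≤ a := by omega
    have haR : (1 : ℝ) ≤ a := by exact_mod_cast ha1
    have hf := add_le_huberF ha1
    have hlog : Real.log a + 1 / (a + 1) ≤ Real.log ((a : ℝ) + 1) := by
      have h := Real.one_sub_inv_le_log_of_pos (x := ((a : ℝ) + 1) / a) (by positivity)
      rw [Real.log_div (by positivity) (by positivity), inv_div] at h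
      have : 1 - (a : ℝ) / (a + 1) = 1 / (a + 1) := by field_simp; ring
      linarith
    have h1 : 1 / (2 * huberF a) ≤ 1 / (2 * ((a : ℝ) + 1.7)) := by gcongr
    have h2 : 0.6 / (2 * huberF a ^ 2) ≤ 0.6 / (2 * ((a : ℝ) + 1.7) ^ 2) := by gcongr
    have h3 : 1 / (2 * ((a : ℝ) + 1.7)) + 0.6 / (2 * ((a : ℝ) + 1.7) ^ 2)
        ≤ 1 / (a + 1) / 2 := by
      rw [div_add_div _ _ (by positivity) (by positivity), div_div,
        div_le_div_iff₀ (by positivity) (by positivity)]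
      nlinarith [mul_nonneg (show (0 : ℝ) ≤ a by linarith) (show (0 : ℝ) ≤ a by linarith)]
    rw [huberF_succ_of_pos ha1]
    push_cast
    linarith

theorem exp_le_mul_sqrt_two_pi : Real.exp 1.82 ≤ 19 * Real.sqrt (2 * Real.pi) / Real.exp 2 := by
  rw [le_div_iff₀ (Real.exp_pos _), ← Real.exp_add]
  refine (pow_le_pow_iff_left₀ (Real.exp_pos _).le (by positivity) two_ne_zero).1 ?_
  rw [mul_pow, Real.sq_sqrt (by positivity), ← Real.exp_nat_mul]
  have hpi := Real.pi_gt_d2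
  have h1 : Real.exp 8 ≤ 2.7183 ^ 8 := by
    have : Real.exp 8 = Real.exp 1 ^ 8 := by rw [← Real.exp_nat_mul]; norm_num
    rw [this]
    have := Real.exp_one_lt_d9
    gcongr
    linarith
  -- After squaring, the exponent is 2·3.82 = 7.64 = 8 - 0.36, and 1.4248 = 1 + 0.36 + 0.36²/2.
  have h2 := Real.quadratic_le_exp_of_nonneg (x := 0.36) (by norm_num)
  have h3 : Real.exp (((2 : ℕ) : ℝ) * (1.82 + 2)) * Real.exp 0.36 = Real.exp 8 := by
    rw [← Real.exp_add]; norm_num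
  have h4 : Real.exp (((2 : ℕ) : ℝ) * (1.82 + 2)) * 1.4248 ≤ 2.7183 ^ 8 := by
    refine le_trans ?_ (h3.le.trans h1)
    refine mul_le_mul_of_nonneg_left ?_ (Real.exp_pos _).le
    norm_num at h2 ⊢
    linarith
  norm_num at h4 ⊢
  linarith

theorem gEst_div_eq {ρ : ℝ} {n : ℕ} (hn : 0 < n) :
    gEst ρ n / (Real.sqrt (2 * Real.pi * n) * Real.exp 2)
      = Real.sqrt (2 * Real.pi * n) * Real.exp (1 / (3 * n)) * (n / Real.exp 1) ^ n *
        (1 - ρ / n ^ 2) ^ n / Real.exp 2 := by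
  have hn' : (0 : ℝ) < n := by exact_mod_cast hn
  have hs : 0 < Real.sqrt (2 * Real.pi * n) := Real.sqrt_pos.2 (by positivity)
  have h2 : 2 * Real.pi * n = Real.sqrt (2 * Real.pi * n) * Real.sqrt (2 * Real.pi * n) :=
    (Real.mul_self_sqrt (by positivity)).symm
  rw [gEst, Real.rpow_natCast, Real.rpow_natCast]
  nth_rewrite 1 [h2]
  field_simp

theorem one_sub_div_sq_pow_le {n D k : ℕ} (hn : 2 ≤ n) (hD : 20 * D ^ 2 + 2 ≤ n)
    (hk : k ≤ n * D) :
    ∃ x : ℝ, 0 ≤ x ∧ x ≤ 1 ∧ 1 ≤ n * (x * (1 - x) ^ (2 * D)) ∧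
      Real.exp (1 / (3 * n)) * (1 - (k : ℝ) / n ^ 2) ^ n / Real.exp 2 ≤ (1 - x) ^ k := by
  have hnR : (2 : ℝ) ≤ n := by exact_mod_cast hn
  have hn0 : (0 : ℝ) < n := by linarith
  have hDR : 20 * (D : ℝ) ^ 2 + 2 ≤ n := by exact_mod_cast hD
  have hkR : (k : ℝ) ≤ n * D := by exact_mod_cast hk
  have hD0 : (0 : ℝ) ≤ D := Nat.cast_nonneg D
  obtain ⟨t, ht⟩ : ∃ t : ℝ, t = D / n := ⟨_, rfl⟩
  have ht0 : 0 ≤ t := ht ▸ by positivity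
  have ht1 : t ≤ 1 / 10 := by
    rw [ht, div_le_iff₀ hn0]
    nlinarith [sq_nonneg ((D : ℝ) - 1 / 4)]
  have htD : D * t ≤ 1 / 20 := by
    rw [ht, ← mul_div_assoc, div_le_iff₀ hn0]
    linarith
  -- By Bernoulli, (1-x)^(2D) ≥ 1 - 2t(1+4t); the surplus 4t in nx pays for this loss when t ≤ 1/10.
  obtain ⟨x, hx⟩ : ∃ x : ℝ, x = (1 + 4 * t) / n := ⟨_, rfl⟩
  have hnx : n * x = 1 + 4 * t := by rw [hx]; field_simp
  have hx0 : 0 ≤ x := by rw [hx]; positivity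
  have hx7 : x ≤ 0.7 := by
    rw [hx, div_le_iff₀ hn0]
    linarith
  have hDx : D * x = t * (1 + 4 * t) := by rw [hx, ht]; ring
  refine ⟨x, hx0, by linarith, ?_, ?_⟩
  · have hb := one_add_mul_le_pow (a := -x) (by linarith) (2 * D)
    rw [← sub_eq_add_neg] at hb
    push_cast at hb
    calc (1 : ℝ) ≤ (1 + 4 * t) * (1 - 2 * (t * (1 + 4 * t))) := by
          nlinarith [mul_nonneg ht0 ht0, mul_nonneg ht0 (sub_nonneg.2 ht1),
            mul_nonneg (mul_nonneg ht0 ht0) (sub_nonneg.2 ht1)]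
      _ = n * x * (1 + 2 * D * -x) := by rw [hnx, ← hDx]; ring
      _ ≤ n * x * (1 - x) ^ (2 * D) := mul_le_mul_of_nonneg_left hb (by positivity)
      _ = _ := by ring
  · have h1x : 0 < 1 - x := by linarith
    obtain ⟨d, hd⟩ : ∃ d : ℝ, d = k / n := ⟨_, rfl⟩
    have hd0 : 0 ≤ d := by rw [hd]; positivity
    have hdD : d ≤ D := by rw [hd, div_le_iff₀ hn0]; linarith
    have hkd : (k : ℝ) = n * d := by rw [hd]; field_simp
    have hkn : (k : ℝ) / n ^ 2 = d / n := by rw [hkd]; field_simp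
    have hdn : d / n ≤ 1 := by
      rw [div_le_one hn0]
      nlinarith
    have h1 : (1 - (k : ℝ) / n ^ 2) ^ n ≤ Real.exp (-d) := by
      rw [hkn]
      calc (1 - d / n) ^ n ≤ Real.exp (-(d / n)) ^ n :=
            pow_le_pow_left₀ (by linarith) (Real.one_sub_le_exp_neg _) n
        _ = Real.exp (-d) := by
            rw [← Real.exp_nat_mul]
            congr 1
            field_simp
    have h2 : Real.exp (-(x / (1 - x))) ≤ 1 - x := by
      rw [Real.exp_neg]
      refine inv_le_of_inv_le₀ h1x ?_
      have := Real.add_one_le_exp (x / (1 - x))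
      have h : (1 - x)⁻¹ = x / (1 - x) + 1 := by field_simp; ring
      rwa [h]
    -- The excess over d is at most 1.2, while 2 - 1/(3n) ≥ 11/6.
    have h3 : k * (x / (1 - x)) ≤ d + (2 - 1 / (3 * n)) := by
      have e1 : (k : ℝ) * (x / (1 - x)) = d + d * (4 * t + x) / (1 - x) := by
        rw [hkd]
        have : n * d * (x / (1 - x)) = d * (n * x) / (1 - x) := by ring
        rw [this, hnx]
        field_simp
        ring
      have e2 : d * (4 * t + x) / (1 - x) ≤ 1.2 := by
        rw [div_le_iff₀ h1x]
        have : d * (4 * t + x) ≤ D * (4 * t + x) :=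
          mul_le_mul_of_nonneg_right hdD (by positivity)
        nlinarith
      have e3 : 1 / (3 * (n : ℝ)) ≤ 1 / (3 * 2) := by gcongr
      linarith
    calc Real.exp (1 / (3 * n)) * (1 - (k : ℝ) / n ^ 2) ^ n / Real.exp 2
        ≤ Real.exp (1 / (3 * n)) * Real.exp (-d) / Real.exp 2 := by gcongr
      _ = Real.exp (-(d + (2 - 1 / (3 * n)))) := by
          rw [← Real.exp_add, ← Real.exp_sub]
          congr 1
          ring
      _ ≤ Real.exp (-(k * (x / (1 - x)))) := Real.exp_le_exp.2 (neg_le_neg h3)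
      _ = Real.exp (-(x / (1 - x))) ^ k := by
          rw [← Real.exp_nat_mul]
          congr 1
          ring
      _ ≤ (1 - x) ^ k := pow_le_pow_left₀ (Real.exp_pos _).le h2 k

theorem half_log_mul_div_le {n : ℕ} {d : ℝ}
    (hd : d ≤ Real.sqrt (((n : ℝ) - 2) / 20)) (hd' : d = 0 ∨ 22 ≤ n) (hd0 : 0 ≤ d) :
    (Real.log n / 2 + 1.62) * d / (n - d) ≤ 0.2 := by
  rcases hd' with rfl | h22
  · norm_num
  have hnR : (22 : ℝ) ≤ n := by exact_mod_cast h22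
  obtain ⟨u, hu⟩ : ∃ u, u = Real.sqrt n := ⟨_, rfl⟩
  have hun : u ^ 2 = n := by rw [hu]; exact Real.sq_sqrt (by linarith)
  have hu0 : 0 ≤ u := hu ▸ Real.sqrt_nonneg _
  have hu4 : 4.5 ≤ u := by
    rw [hu]
    exact Real.le_sqrt_of_sq_le (by norm_num; linarith)
  have hdu : d ≤ 0.2237 * u := by
    refine hd.trans (Real.sqrt_le_iff.2 ⟨by positivity, ?_⟩)
    rw [mul_pow, hun]
    norm_num
    linarith
  have hlog : Real.log n / 2 ≤ u / 2 - 1 + 0.694 := by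
    have h1 : Real.log n = 2 * Real.log u := by rw [← hun, Real.log_pow]; norm_num
    -- Tangent line of log at u = 2, where u = √n.
    have h2 := Real.log_le_sub_one_of_pos (x := u / 2) (by linarith)
    rw [Real.log_div (by linarith) (by norm_num)] at h2
    have h3 := Real.log_two_lt_d9
    linarith
  rw [div_le_iff₀ (by nlinarith), ← hun]
  have h1 : (Real.log (u ^ 2) / 2 + 1.62) * d ≤ (u / 2 + 1.314) * (0.2237 * u) := by
    rw [hun]
    exact mul_le_mul (by linarith) hdu hd0 (by linarith)
  nlinarith

/-- The tangent bound y ≤ exp(y - 1) at y = (r i + L)/(n - d) makes the product depend only on the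
sum of the r i. The exponent totals L + L·d/(n - d) ≤ (log n)/2 + 1.62 + 0.2. -/
theorem prod_huberF_le_gEst {n : ℕ} (hn : 2 ≤ n) (r : Fin n → ℕ) (hr2 : ∀ i, 2 ≤ r i)
    (hrn : ∀ i, r i ≤ n) {d : ℝ} (hsum : ∑ i, (r i : ℝ) = n * (n - d))
    (hd0 : 0 ≤ d) (hd : d ≤ Real.sqrt (((n : ℝ) - 2) / 20)) (hd' : d = 0 ∨ 22 ≤ n) :
    ∏ i, (huberF (r i) / Real.exp 1) ≤
      19 * (gEst (n * d) n / (Real.sqrt (2 * Real.pi * n) * Real.exp 2)) := by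
  have hnR : (2 : ℝ) ≤ n := by exact_mod_cast hn
  have hn0 : (0 : ℝ) < n := by linarith
  have hdn : d < n := by
    refine hd.trans_lt ((Real.sqrt_lt' hn0).2 ?_)
    nlinarith
  have hnd : 0 < n - d := by linarith
  obtain ⟨L, hL⟩ : ∃ L, L = Real.log n / 2 + 1.62 := ⟨_, rfl⟩
  have hlog : 0 ≤ Real.log n := Real.log_nonneg (by linarith)
  have hfac : ∀ i, huberF (r i) / Real.exp 1
      ≤ (n - d) / Real.exp 1 * Real.exp ((r i + L) / (n - d) - 1) := by
    intro i
    have h1 := huberF_le_add_log (hr2 i)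
    have h2 : Real.log (r i) ≤ Real.log n := by
      refine Real.log_le_log ?_ (by exact_mod_cast hrn i)
      have := hr2 i
      exact_mod_cast (by omega : 0 < r i)
    have h3 := Real.add_one_le_exp (((r i : ℝ) + L) / (n - d) - 1)
    rw [sub_add_cancel, div_le_iff₀ hnd] at h3
    rw [div_mul_eq_mul_div]
    gcongr
    linarith
  have hbound : L + L * d / (n - d) ≤ Real.log n / 2 + 1.82 := by
    have := half_log_mul_div_le hd hd' hd0
    rw [← hL] at this
    rw [hL] at this ⊢
    linarith
  have hexp : Real.exp (L + L * d / (n - d)) ≤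
      19 * Real.sqrt (2 * Real.pi * n) / Real.exp 2 := by
    refine (Real.exp_le_exp.2 hbound).trans ?_
    have hs : Real.exp (Real.log n / 2) = Real.sqrt n := by
      rw [← Real.exp_log (Real.sqrt_pos.2 hn0), Real.log_sqrt hn0.le]
    rw [Real.exp_add, hs, Real.sqrt_mul (by positivity)]
    calc _ ≤ Real.sqrt n * (19 * Real.sqrt (2 * Real.pi) / Real.exp 2) :=
          mul_le_mul_of_nonneg_left exp_le_mul_sqrt_two_pi (Real.sqrt_nonneg _)
      _ = _ := by ring
  have hpow : ((n - d) / Real.exp 1) ^ n = (n / Real.exp 1) ^ n * (1 - n * d / n ^ 2) ^ n := by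
    rw [← mul_pow]
    congr 1
    field_simp
  calc ∏ i, (huberF (r i) / Real.exp 1)
      ≤ ∏ i, ((n - d) / Real.exp 1 * Real.exp ((r i + L) / (n - d) - 1)) :=
        Finset.prod_le_prod (fun i _ => div_nonneg (huberF_nonneg _) (Real.exp_pos _).le)
          fun i _ => hfac i
    _ = ((n - d) / Real.exp 1) ^ n * Real.exp (L + L * d / (n - d)) := by
        rw [Finset.prod_mul_distrib, Finset.prod_const, ← Real.exp_sum, Finset.card_univ,
          Fintype.card_fin]
        congr 2
        rw [Finset.sum_sub_distrib, ← Finset.sum_div, Finset.sum_add_distrib, hsum]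
        simp only [Finset.sum_const, Finset.card_univ, Fintype.card_fin, nsmul_eq_mul]
        field_simp
        ring
    _ ≤ ((n - d) / Real.exp 1) ^ n * (19 * Real.sqrt (2 * Real.pi * n) / Real.exp 2) :=
        mul_le_mul_of_nonneg_left hexp (by positivity)
    _ ≤ ((n - d) / Real.exp 1) ^ n * (19 * Real.sqrt (2 * Real.pi * n) / Real.exp 2) *
          Real.exp (1 / (3 * n)) :=
        le_mul_of_one_le_right (by positivity) (Real.one_le_exp (by positivity))
    _ = _ := by
        rw [gEst_div_eq (by omega), hpow]
        ring

/-! ### Assembly of the bounds -/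

theorem prpSolutions_bounds {n : ℕ} (hn : 2 ≤ n) (R : Fin n → Finset (Fin n))
    (hrow : ∀ i, (n : ℝ) - Real.sqrt (((n : ℝ) - 2) / 20) ≤ ((R i).card : ℝ))
    (hcol : ∀ j, (n : ℝ) - Real.sqrt (((n : ℝ) - 2) / 20)
        ≤ ((Finset.card {k : Fin n | j ∈ R k} : ℕ) : ℝ)) (ρ : ℝ)
    (hρ : ρ = (n : ℝ) ^ 2 - ∑ i, ((R i).card : ℝ)) :
    gEst ρ (n : ℝ) / (Real.sqrt (2 * Real.pi * n) * Real.exp 2) ≤ ((prpSolutions R).card : ℝ) ∧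
      ((prpSolutions R).card : ℝ) ≤ ∏ i, (huberF (R i).card / Real.exp 1) ∧
      ∏ i, (huberF (R i).card / Real.exp 1)
        ≤ 19 * (gEst ρ (n : ℝ) / (Real.sqrt (2 * Real.pi * n) * Real.exp 2)) := by
  have hnR : (2 : ℝ) ≤ n := by exact_mod_cast hn
  have hn0 : (0 : ℝ) < n := by linarith
  obtain ⟨s, hs⟩ : ∃ s, s = Real.sqrt (((n : ℝ) - 2) / 20) := ⟨_, rfl⟩
  have hs0 : 0 ≤ s := hs ▸ Real.sqrt_nonneg _
  have hs2 : 20 * s ^ 2 + 2 = n := by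
    rw [hs, Real.sq_sqrt (by linarith)]
    ring
  rw [← hs] at hrow hcol
  have hRn : ∀ i, (R i).card ≤ n := fun i => by simpa using Finset.card_le_univ (R i)
  have hR2 : ∀ i, 2 ≤ (R i).card := by
    intro i
    have h : (1 : ℝ) < (R i).card := by nlinarith [hrow i, sq_nonneg (s - 1 / 40)]
    exact_mod_cast h
  obtain ⟨d, hd⟩ : ∃ d : ℝ, d = ρ / n := ⟨_, rfl⟩
  have hρd : ρ = n * d := by rw [hd]; field_simp
  have hcard : ∑ i : Fin n, ((n : ℝ) - (R i).card) = ρ := by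
    rw [Finset.sum_sub_distrib, hρ]
    simp [sq]
  have hupper : ((prpSolutions R).card : ℝ) ≤ ∏ i, huberF (R i).card / Real.exp 1 := by
    convert card_equiv_filter_le_prod_huberF n (Fin n) (Fin n) (Fintype.card_fin n) R
    ext σ
    simp [prpSolutions]
  refine ⟨?_, hupper, ?_⟩
  -- The numbers of missing cells are integers, so the real bound s may be replaced by its floor.
  · obtain ⟨D, hD⟩ : ∃ D, D = ⌊s⌋₊ := ⟨_, rfl⟩
    have hDs : (D : ℝ) ≤ s := hD ▸ Nat.floor_le hs0
    have hDn : 20 * D ^ 2 + 2 ≤ n := by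
      have : 20 * (D : ℝ) ^ 2 + 2 ≤ n := by rw [← hs2]; gcongr
      exact_mod_cast this
    obtain ⟨Z, hZ⟩ : ∃ Z : Finset (Fin n × Fin n),
      Z = Finset.univ.filter fun p => p.2 ∉ R p.1 := ⟨_, rfl⟩
    have hZrow' : ∀ i, (Z.filter fun p => p.1 = i).card = n - (R i).card := by
      intro i
      have : (Z.filter fun p => p.1 = i) = (R i)ᶜ.map ⟨Prod.mk i, Prod.mk_right_injective i⟩ := by
        ext ⟨a, b⟩
        simp only [hZ, Finset.mem_filter, Finset.mem_univ, true_and, Finset.mem_map,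
          Finset.mem_compl, Function.Embedding.coeFn_mk, Prod.mk.injEq]
        constructor
        · rintro ⟨h, rfl⟩
          exact ⟨b, h, rfl, rfl⟩
        · rintro ⟨c, h, rfl, rfl⟩
          exact ⟨h, rfl⟩
      rw [this, Finset.card_map, Finset.card_compl, Fintype.card_fin]
    have hle : ∀ m : ℕ, m ≤ n → (n : ℝ) - s ≤ m → n - m ≤ D := by
      intro m hm h
      rw [hD]
      refine Nat.le_floor ?_
      rw [Nat.cast_sub hm]
      linarith
    have hZrow : ∀ i, (Z.filter fun p => p.1 = i).card ≤ D := fun i => by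
      rw [hZrow']
      exact hle _ (hRn i) (hrow i)
    have hZcol : ∀ j, (Z.filter fun p => p.2 = j).card ≤ D := by
      intro j
      have : (Z.filter fun p => p.2 = j) = (Finset.univ.filter fun k : Fin n => j ∈ R k)ᶜ.map
          ⟨fun k => (k, j), Prod.mk_left_injective j⟩ := by
        ext ⟨a, b⟩
        simp only [hZ, Finset.mem_filter, Finset.mem_univ, true_and, Finset.mem_map,
          Finset.mem_compl, Function.Embedding.coeFn_mk, Prod.mk.injEq]
        constructor
        · rintro ⟨h, rfl⟩
          exact ⟨a, h, rfl, rfl⟩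
        · rintro ⟨c, h, rfl, rfl⟩
          exact ⟨h, rfl⟩
      rw [this, Finset.card_map, Finset.card_compl, Fintype.card_fin]
      exact hle _ (by simpa using Finset.card_le_univ (Finset.univ.filter fun k => j ∈ R k))
        (hcol j)
    have hZsum : Z.card = ∑ i, (Z.filter fun p => p.1 = i).card :=
      Finset.card_eq_sum_card_fiberwise fun _ _ => Finset.mem_coe.2 (Finset.mem_univ _)
    have hZρ : (Z.card : ℝ) = ρ := by
      rw [hZsum, ← hcard, Nat.cast_sum]
      exact Finset.sum_congr rfl fun i _ => by rw [hZrow', Nat.cast_sub (hRn i)]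
    have hZle : Z.card ≤ n * D := by
      rw [hZsum]
      simpa using Finset.sum_le_card_nsmul Finset.univ _ D fun i _ => hZrow i
    have havoid : avoidCount Z = (prpSolutions R).card := by
      simp [avoidCount, prpSolutions, hZ]
    obtain ⟨x, hx0, hx1, hx, hxk⟩ := one_sub_div_sq_pow_le hn hDn hZle
    have h := pow_card_mul_factorial_le_avoidCount (by omega) hx0 hx1 hx Z hZrow hZcol
    rw [havoid] at h
    refine le_trans ?_ h
    rw [gEst_div_eq (by omega), ← hZρ]
    have hst := Stirling.le_factorial_stirling n
    calc _ = (Real.exp (1 / (3 * n)) * (1 - (Z.card : ℝ) / n ^ 2) ^ n / Real.exp 2) *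
          (Real.sqrt (2 * Real.pi * n) * (n / Real.exp 1) ^ n) := by ring
      _ ≤ (1 - x) ^ Z.card * (Real.sqrt (2 * Real.pi * n) * (n / Real.exp 1) ^ n) :=
          mul_le_mul_of_nonneg_right hxk (by positivity)
      _ ≤ _ := mul_le_mul_of_nonneg_left hst (pow_nonneg (by linarith) _)
  · rw [hρd]
    have hsub : ∀ i, (0 : ℝ) ≤ (n : ℝ) - (R i).card := fun i =>
      sub_nonneg.2 (by exact_mod_cast hRn i)
    refine prod_huberF_le_gEst hn _ hR2 hRn ?_ ?_ ?_ ?_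
    · have : ∑ i, ((R i).card : ℝ) = (n : ℝ) ^ 2 - ρ := by rw [hρ]; ring
      rw [this, hρd]
      ring
    · rw [hd, ← hcard]
      exact div_nonneg (Finset.sum_nonneg fun i _ => hsub i) hn0.le
    · rw [← hs, hd, div_le_iff₀ hn0, ← hcard]
      have := Finset.sum_le_card_nsmul Finset.univ (fun i => (n : ℝ) - (R i).card) s
        fun i _ => by linarith [hrow i]
      simp only [Finset.card_univ, Fintype.card_fin, nsmul_eq_mul] at this
      linarith
    -- For n < 22 the allowed deficiency s is below 1, so integrality forces every row to be full
    -- and d = 0.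
    · refine or_iff_not_imp_right.2 fun h22 => ?_
      have hnlt : (n : ℝ) < 22 := by exact_mod_cast not_le.1 h22
      have hs1 : s < 1 := by nlinarith
      have hfull : ∀ i, (R i).card = n := by
        intro i
        have h : (n : ℝ) < (R i).card + 1 := by linarith [hrow i]
        have h' : n < (R i).card + 1 := by exact_mod_cast h
        have := hRn i
        omega
      rw [hd, ← hcard]
      simp [hfull]

theorem mainTheorem1 (n : ℕ) (hn : 2 ≤ n) :
    (∀ A : Matrix (Fin n) (Fin n) ℝ,
      (∀ i j, A i j = 0 ∨ A i j = 1) →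
      (∀ i, (n : ℝ) - Real.sqrt (((n : ℝ) - 2) / 20) < ∑ j, A i j) →
      (∀ j, (n : ℝ) - Real.sqrt (((n : ℝ) - 2) / 20) < ∑ i, A i j) →
      gEst (zeroCount A : ℝ) (n : ℝ) / (Real.sqrt (2 * Real.pi * n) * Real.exp 2)
          ≤ A.permanent ∧
        A.permanent ≤
          19 * (gEst (zeroCount A : ℝ) (n : ℝ) / (Real.sqrt (2 * Real.pi * n) * Real.exp 2))) ∧
    (∀ R : Fin n → Finset (Fin n),
      (∀ i, (n : ℝ) - Real.sqrt (((n : ℝ) - 2) / 20) ≤ ((R i).card : ℝ)) →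
      (∀ j, (n : ℝ) - Real.sqrt (((n : ℝ) - 2) / 20)
        ≤ ((Finset.card {k : Fin n | j ∈ R k} : ℕ) : ℝ)) →
      ∀ ρ : ℝ, ρ = (n : ℝ) ^ 2 - ∑ i, ((R i).card : ℝ) →
      gEst ρ (n : ℝ) / (Real.sqrt (2 * Real.pi * n) * Real.exp 2)
          ≤ ((prpSolutions R).card : ℝ) ∧
        ((prpSolutions R).card : ℝ) ≤ ∏ i, (huberF (R i).card / Real.exp 1) ∧
        ∏ i, (huberF (R i).card / Real.exp 1)
          ≤ 19 * (gEst ρ (n : ℝ) / (Real.sqrt (2 * Real.pi * n) * Real.exp 2))) := by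
  refine ⟨fun A hA hrow hcol => ?_, fun R => prpSolutions_bounds hn R⟩
  have hA' : ∀ i j, A i j = if A i j = 1 then 1 else 0 := fun i j => by
    rcases hA i j with h | h <;> simp [h]
  obtain ⟨R, hR⟩ : ∃ R : Fin n → Finset (Fin n),
    R = fun i => Finset.univ.filter fun j => A i j = 1 := ⟨_, rfl⟩
  have hmem : ∀ i j, j ∈ R i ↔ A i j = 1 := fun i j => by simp [hR]
  have hRrow : ∀ i, ((R i).card : ℝ) = ∑ j, A i j := fun i => by
    rw [Finset.sum_congr rfl fun j _ => hA' i j, Finset.sum_boole, hR]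
  have hRcol : ∀ j, ((Finset.card {k : Fin n | j ∈ R k} : ℕ) : ℝ) = ∑ i, A i j := fun j => by
    rw [Finset.sum_congr rfl fun i _ => hA' i j, Finset.sum_boole]
    simp only [hmem]
  have hper : A.permanent = ((prpSolutions R).card : ℝ) := by
    -- `Matrix.permanent` multiplies the entries `A (σ i) i`; transposing gives `A i (σ i)`,
    -- matching `prpSolutions`.
    rw [← Matrix.permanent_transpose, Matrix.permanent, prpSolutions, ← Finset.sum_boole]
    refine Finset.sum_congr rfl fun σ _ => ?_
    simp only [Matrix.transpose_apply, hmem]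
    rw [Finset.prod_congr rfl fun i _ => hA' i (σ i), Finset.prod_boole]
    simp
  have hzero : (zeroCount A : ℝ) = (n : ℝ) ^ 2 - ∑ i, ((R i).card : ℝ) := by
    have h1 : (zeroCount A : ℝ) = ∑ i, ∑ j, (1 - A i j) := by
      rw [zeroCount, ← Finset.sum_boole, Fintype.sum_prod_type]
      refine Finset.sum_congr rfl fun i _ => Finset.sum_congr rfl fun j _ => ?_
      rcases hA i j with h | h <;> simp [h]
    rw [h1, Finset.sum_congr rfl fun i _ => hRrow i]
    simp [Finset.sum_sub_distrib, sq]
  obtain ⟨h1, h2, h3⟩ := prpSolutions_bounds hn R (fun i => (hRrow i).symm ▸ (hrow i).le)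
    (fun j => (hRcol j).symm ▸ (hcol j).le) _ hzero
  rw [hper]
  exact ⟨h1, h2.trans h3⟩
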